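/- Let $K_n=(V_n,E_n)$ be the complete graph on $n$ vertices. For $X\subseteq V_n$ let $\delta(X)\subseteq E_n$ be the set of edges with exactly one endpoint in $X$, let $\chi^{\delta(X)}\in\{0,1\}^{E_n}$ be its characteristic vector, and let $\mathrm{CUT}(n)=\operatorname{conv}\{\chi^{\delta(X)} : X\subseteq V_n\}\subseteq\mathbb R^{E_n}$ be the cut polytope. Consider systems $Ex+Fy=g,\ y\ge \mathbf 0$ with $x\in\mathbb R^{E_n}$, $y\in\mathbb R^r$ and finitely many equations; the size of such a system is the number $r$ of its inequalities, and its projection is $K=\{x : \exists y\ge\mathbf 0,\ Ex+Fy=g\}$. For $P\subseteq Q\subseteq\mathbb R^{E_n}$ let $\mathrm{xc}(P,Q)$ be the minimum size of a system with $P\subseteq K\subseteq Q$. For $\rho\ge1$, the system is a $\rho$-approximate extended formulation of Max CUT with arbitrary weights if for every $w\in\mathbb R^{E_n}$ $$\max_{x\in \mathrm{CUT}(n)} w^{\intercal}x\ \le\ \sup_{x\in K} w^{\intercal}x\ \le\ \rho\max_{x\in \mathrm{CUT}(n)} w^{\intercal}x .$$ Then there are a constant $c>0$ and an integer $N$, both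 independent of $\rho$, such that for all $\rho\ge 1$ and all $n\ge N$: every $\rho$-approximate extended formulation of Max CUT with arbitrary weights on $n$ vertices has size at least $2^{cn}$, and $\mathrm{xc}(\mathrm{CUT}(n),\rho\,\mathrm{CUT}(n))\ge 2^{cn}$. -/

import Mathlib

open scoped Pointwise

namespace ApproxEF

/-- A system `E x + F y = g`, `y ≥ 0` in the variables `(x, y) ∈ ℝ^ι × ℝ^r`, with any finite
number `m` of equations and `r` additional variables. -/
structure ExtSystem (ι : Type) where
  /-- number of equations -/
  m : ℕ
  /-- number of additional (nonnegative) variables -/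
  r : ℕ
  E : Matrix (Fin m) ι ℝ
  F : Matrix (Fin m) (Fin r) ℝ
  g : Fin m → ℝ

namespace ExtSystem

variable {ι : Type}

/-- The size of the system: the number of its inequalities `y_j ≥ 0` (equations are free). -/
def size (S : ExtSystem ι) : ℕ := S.r

/-- The projection `K = {x | ∃ y, E x + F y = g, y ≥ 0}` to `x`-space. -/
def proj [Fintype ι] (S : ExtSystem ι) : Set (ι → ℝ) :=
  {x | ∃ y : Fin S.r → ℝ, S.E.mulVec x + S.F.mulVec y = S.g ∧ ∀ j, 0 ≤ y j}

/-- `S` is an extended formulation of the pair `P, Q`: `P ⊆ K ⊆ Q`. -/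
def IsEFOfPair [Fintype ι] (S : ExtSystem ι) (P Q : Set (ι → ℝ)) : Prop :=
  P ⊆ S.proj ∧ S.proj ⊆ Q

end ExtSystem

/-- The extension complexity `xc(P, Q)`: the minimum size of an extended formulation of the pair
`P, Q`. (It is `0` if there is none, so a positive lower bound for it includes existence.) -/
noncomputable def xc {ι : Type} [Fintype ι] (P Q : Set (ι → ℝ)) : ℕ :=
  sInf {k : ℕ | ∃ S : ExtSystem ι, S.IsEFOfPair P Q ∧ S.size = k}

/-- A linear encoding of a maximization problem in one fixed dimension: the feasible solutions,
which are 0/1-vectors, and the admissible objective functions. -/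
structure MaxEncoding (ι : Type) where
  feasible : Set (ι → ℝ)
  feasible_binary : ∀ x ∈ feasible, ∀ i, x i = 0 ∨ x i = 1
  objectives : Set (ι → ℝ)

/-- The convex hull `P` of the feasible solutions. -/
def MaxEncoding.hull {ι : Type} (M : MaxEncoding ι) : Set (ι → ℝ) :=
  convexHull ℝ M.feasible

/-- The optimal value `sup {w · x | x ∈ K}` of the linear objective `w` over `K`,
`+∞` if unbounded and `-∞` if `K` is empty. -/
noncomputable def optValue {ι : Type} [Fintype ι] (w : ι → ℝ) (K : Set (ι → ℝ)) : EReal :=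
  ⨆ x ∈ K, ((w ⬝ᵥ x : ℝ) : EReal)

/-- `S` is a `ρ`-approximate extended formulation of the maximization problem encoded by `M`. -/
def ExtSystem.IsApproxEF {ι : Type} [Fintype ι] (S : ExtSystem ι) (M : MaxEncoding ι) (ρ : ℝ) :
    Prop :=
  (∀ w : ι → ℝ, optValue w M.hull ≤ optValue w S.proj) ∧
    ∀ w ∈ M.objectives, optValue w S.proj ≤ (ρ : EReal) * optValue w M.hull

/-- The edge set `E_n` of the complete graph `K_n` on the vertex set `Fin n`. -/
abbrev Edge (n : ℕ) : Type := (⊤ : SimpleGraph (Fin n)).edgeSet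

/-- The cut `δ(X)`: the edges with one endpoint in `X` and the other outside. -/
def cut {n : ℕ} (X : Set (Fin n)) : Set (Edge n) :=
  {e | ∃ u ∈ X, ∃ v ∉ X, (e : Sym2 (Fin n)) = s(u, v)}

/-- The cut vector `χ^{δ(X)}`, the characteristic vector of the cut `δ(X)`. -/
noncomputable def cutVector {n : ℕ} (X : Set (Fin n)) : Edge n → ℝ :=
  (cut X).indicator 1

/-- The cut polytope `CUT(n)`. -/
def cutPolytope (n : ℕ) : Set (Edge n → ℝ) :=
  convexHull ℝ (Set.range fun X : Set (Fin n) => cutVector X)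

/-- Max CUT on `n` vertices with arbitrary edge weights: the feasible solutions are the cut
vectors, and every weight vector is admissible. -/
noncomputable def maxCut (n : ℕ) : MaxEncoding (Edge n) where
  feasible := Set.range fun X : Set (Fin n) => cutVector X
  feasible_binary := by
    rintro _ ⟨X, rfl⟩ e
    by_cases h : e ∈ cut X
    · right
      simp [cutVector, h]
    · left
      simp [cutVector, h]
  objectives := Set.univ

end ApproxEF

open ApproxEF

/-! The factor `ρ` has no effect on inequalities with right-hand side `0`: if `w · x ≤ 0` holds on
the cut polytope, it holds on every relaxation considered here. Enough such inequalities exist to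
force exponential size.

For integers `z` with sum `1`, the form with coefficients `z u * z v` takes the value `t * (1 - t) ≤
0` at a cut `X`, where `t = z(X)`. Suitable `z` (from a set `a`) and `X` (from a set `b`) give `t =
#(a ∩ b) - 1`: the value is `-2` if `a` and `b` are disjoint, and `0` if they meet in one element.
Each variable `y j` yields a rectangle of pairs `(a, b)` avoiding `#(a ∩ b) = 1`, and together these
rectangles cover all disjoint pairs (`three_pow_le_size`). There are `3 ^ m` disjoint pairs and at
most `2 ^ m` in one rectangle (`disjointPairs_le_two_pow`), so the size is at least `(3 / 2) ^ m`,
with `n = m + 2`. -/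

/-! ### Rectangle covers of the disjoint pairs -/

section Rectangles

open Finset

variable {α : Type*} [DecidableEq α]

/-- The number of disjoint pairs of subsets of `s` in the rectangle `{a | P a} × {b | Q b}`. -/
noncomputable def disjointPairs (s : Finset α) (P Q : Finset α → Prop) : ℕ :=
  open Classical in
  ∑ a ∈ s.powerset, ∑ b ∈ s.powerset, if P a ∧ Q b ∧ Disjoint a b then 1 else 0

theorem disjointPairs_insert {s : Finset α} {x : α} (hx : x ∉ s) (P Q : Finset α → Prop) :
    disjointPairs (insert x s) P Q = disjointPairs s P Q +
      disjointPairs s P (fun b => Q (insert x b)) +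
      disjointPairs s (fun a => P (insert x a)) Q := by
  classical
  unfold disjointPairs
  rw [sum_powerset_insert hx]
  simp only [sum_powerset_insert hx, ← sum_add_distrib]
  refine sum_congr rfl fun a ha => sum_congr rfl fun b hb => ?_
  have hxa : x ∉ a := fun h => hx (mem_powerset.1 ha h)
  have hxb : x ∉ b := fun h => hx (mem_powerset.1 hb h)
  simp [hxa, hxb, disjoint_insert_left, disjoint_insert_right]

theorem disjointPairs_true (s : Finset α) :
    disjointPairs s (fun _ => True) (fun _ => True) = 3 ^ #s := by
  induction s using Finset.induction_on with
  | empty => simp [disjointPairs]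
  | insert x s hx ih => rw [disjointPairs_insert hx, ih, card_insert_of_notMem hx]; ring

/-- A rectangle of pairs of subsets of `s` none of which meet in exactly one element contains at
most `2 ^ #s` disjoint pairs. -/
theorem disjointPairs_le_two_pow (s : Finset α) (P Q : Finset α → Prop)
    (h : ∀ a ⊆ s, ∀ b ⊆ s, P a → Q b → #(a ∩ b) ≠ 1) : disjointPairs s P Q ≤ 2 ^ #s := by
  classical
  induction s using Finset.induction_on generalizing P Q with
  | empty =>
    simp only [disjointPairs, powerset_empty, sum_singleton, card_empty, pow_zero]
    split_ifs <;> simp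
  | insert x s hx ih =>
    -- Forgetting `x` on one side and forbidding it on the other leaves intersections unchanged, so
    -- both smaller rectangles still satisfy the hypothesis.
    have h₁ := ih (fun a => P a ∨ P (insert x a)) Q fun a ha b hb hPa hQb => by
      have hxb : x ∉ b := fun h => hx (hb h)
      rcases hPa with hPa | hPa
      · exact h a (ha.trans (subset_insert _ _)) b (hb.trans (subset_insert _ _)) hPa hQb
      · have := h _ (insert_subset_insert x ha) b (hb.trans (subset_insert _ _)) hPa hQb
        rwa [insert_inter_of_notMem hxb] at this
    have h₂ := ih P (fun b => Q b ∨ Q (insert x b)) fun a ha b hb hPa hQb => by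
      have hxa : x ∉ a := fun h => hx (ha h)
      rcases hQb with hQb | hQb
      · exact h a (ha.trans (subset_insert _ _)) b (hb.trans (subset_insert _ _)) hPa hQb
      · have := h a (ha.trans (subset_insert _ _)) _ (insert_subset_insert x hb) hPa hQb
        rwa [inter_insert_of_notMem hxa] at this
    rw [disjointPairs_insert hx, card_insert_of_notMem hx, pow_succ, mul_two]
    refine le_trans ?_ (add_le_add h₁ h₂)
    unfold disjointPairs
    simp only [← sum_add_distrib]
    refine sum_le_sum fun a ha => sum_le_sum fun b hb => ?_
    rw [mem_powerset] at ha hb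
    by_cases hd : Disjoint a b
    · have hone : P (insert x a) → Q (insert x b) → False := fun hPa hQb => by
        refine h _ (insert_subset_insert x ha) _ (insert_subset_insert x hb) hPa hQb ?_
        rw [← insert_inter_distrib, disjoint_iff_inter_eq_empty.1 hd]
        simp
      by_cases p : P a <;> by_cases p' : P (insert x a) <;> by_cases q : Q b <;>
        by_cases q' : Q (insert x b) <;> simp [p, p', q, q', hd]
      exact hone p' q'
    · simp [hd]

/-- If `r` rectangles, none containing a pair of sets that meet in exactly one element, cover all
disjoint pairs of subsets of `s`, then `3 ^ #s ≤ r * 2 ^ #s`. -/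
theorem three_pow_le_of_rectangle_cover {κ : Type*} [Fintype κ] (s : Finset α)
    (P Q : κ → Finset α → Prop) (hfree : ∀ j, ∀ a b, P j a → Q j b → #(a ∩ b) ≠ 1)
    (hcover : ∀ a b, Disjoint a b → ∃ j, P j a ∧ Q j b) :
    3 ^ #s ≤ Fintype.card κ * 2 ^ #s := by
  classical
  calc 3 ^ #s = disjointPairs s (fun _ => True) (fun _ => True) := (disjointPairs_true s).symm
    _ ≤ ∑ j, disjointPairs s (P j) (Q j) := by
      unfold disjointPairs
      rw [sum_comm (s := (univ : Finset κ))]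
      refine sum_le_sum fun a _ => ?_
      rw [sum_comm (s := (univ : Finset κ))]
      refine sum_le_sum fun b _ => ?_
      by_cases hd : Disjoint a b
      · obtain ⟨j, hP, hQ⟩ := hcover a b hd
        refine le_trans ?_ (single_le_sum
          (f := fun j => if P j a ∧ Q j b ∧ Disjoint a b then 1 else 0)
          (fun _ _ => Nat.zero_le _) (mem_univ j))
        simp [hd, hP, hQ]
      · simp [hd]
    _ ≤ ∑ _j : κ, 2 ^ #s :=
      sum_le_sum fun j _ => disjointPairs_le_two_pow s _ _ fun a _ b _ => hfree j a b
    _ = Fintype.card κ * 2 ^ #s := by simp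

end Rectangles

/-! ### Finitely generated cones are closed -/

section Cones

open Finset

/-- The cone generated by a finite family of vectors in a finite-dimensional space is closed. -/
theorem isClosed_conicalCombinations {κ W : Type*} [AddCommGroup W] [Module ℝ W]
    [TopologicalSpace W] [IsTopologicalAddGroup W] [ContinuousSMul ℝ W] [T2Space W]
    (v : κ → W) (s : Finset κ) :
    IsClosed {x : W | ∃ y : κ → ℝ, (∀ i ∈ s, 0 ≤ y i) ∧ ∑ i ∈ s, y i • v i = x} := by
  classical
  induction s using Finset.strongInduction with
  | H s ih =>
    by_cases hli : LinearIndependent ℝ (fun i : s => v i)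
    · have hcl : IsClosed (Fintype.linearCombination ℝ (fun i : s => v i) ''
          {y | ∀ i, 0 ≤ y i}) := by
        refine (LinearMap.isClosedEmbedding_of_injective ?_).isClosedMap _ ?_
        · exact LinearMap.ker_eq_bot.2
            (linearIndependent_iff_injective_fintypeLinearCombination.1 hli)
        · simp only [Set.ofPred_forall]
          exact isClosed_iInter fun i => isClosed_le continuous_const (continuous_apply i)
      convert hcl using 1
      ext x
      constructor
      · rintro ⟨y, hy, rfl⟩
        refine ⟨fun i => y i, fun i => hy i i.2, ?_⟩
        rw [Fintype.linearCombination_apply]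
        exact sum_coe_sort s fun i => y i • v i
      · rintro ⟨y, hy, rfl⟩
        refine ⟨fun i => if h : i ∈ s then y ⟨i, h⟩ else 0, fun i hi => ?_, ?_⟩
        · simpa [hi] using hy ⟨i, hi⟩
        · rw [Fintype.linearCombination_apply, ← sum_coe_sort]
          simp
    -- Carathéodory's argument: subtracting a multiple of a linear relation removes one generator,
    -- so the cone is a finite union of cones on fewer generators.
    · have hrel : ∃ g : κ → ℝ, ∑ i ∈ s, g i • v i = 0 ∧ ∃ i ∈ s, 0 < g i := by
        obtain ⟨g, hg, i, hi⟩ := Fintype.not_linearIndependent_iff.1 hli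
        have key : ∀ g : s → ℝ, ∑ i, g i • v i = 0 → 0 < g i →
            ∃ g : κ → ℝ, ∑ i ∈ s, g i • v i = 0 ∧ ∃ i ∈ s, 0 < g i := fun g hg hi =>
          ⟨fun i => if h : i ∈ s then g ⟨i, h⟩ else 0, by rw [← sum_coe_sort]; simpa using hg,
            i, i.2, by simpa using hi⟩
        rcases lt_or_gt_of_ne hi with hi | hi
        · exact key (-g) (by simp only [Pi.neg_apply, neg_smul, sum_neg_distrib, hg, neg_zero])
            (by simpa using hi)
        · exact key g hg hi
      obtain ⟨g, hg, i₀, hi₀, hpos⟩ := hrel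
      have hunion : {x : W | ∃ y : κ → ℝ, (∀ i ∈ s, 0 ≤ y i) ∧ ∑ i ∈ s, y i • v i = x} =
          ⋃ k ∈ s, {x : W | ∃ y : κ → ℝ, (∀ i ∈ s.erase k, 0 ≤ y i) ∧
            ∑ i ∈ s.erase k, y i • v i = x} := by
        ext x
        simp only [Set.mem_iUnion, exists_prop]
        constructor
        · rintro ⟨y, hy, rfl⟩
          -- The minimal ratio is the largest multiple of `g` that keeps all coefficients
          -- nonnegative; it cancels the one at `k`.
          obtain ⟨k, hk, hmin⟩ := (s.filter fun i => 0 < g i).exists_min_image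
            (fun i => y i / g i) ⟨i₀, mem_filter.2 ⟨hi₀, hpos⟩⟩
          obtain ⟨hks, hgk⟩ := mem_filter.1 hk
          refine ⟨k, hks, fun i => y i - y k / g k * g i, fun i hi => ?_, ?_⟩
          · have his := mem_of_mem_erase hi
            have hq : 0 ≤ y k / g k := div_nonneg (hy k hks) hgk.le
            rcases le_or_gt (g i) 0 with hgi | hgi
            · nlinarith [hy i his, mul_nonpos_of_nonneg_of_nonpos hq hgi]
            · have := (le_div_iff₀ hgi).1 (hmin i (mem_filter.2 ⟨his, hgi⟩))
              linarith
          · rw [sum_erase _ (by simp [hgk.ne'])]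
            simp only [sub_smul, sum_sub_distrib, mul_smul, ← smul_sum, hg, smul_zero, sub_zero]
        · rintro ⟨k, hk, y, hy, rfl⟩
          refine ⟨fun i => if i = k then 0 else y i, fun i hi => ?_, ?_⟩
          · dsimp only
            split_ifs with h
            · exact le_rfl
            · exact hy i (mem_erase.2 ⟨h, hi⟩)
          · rw [← sum_erase (a := k) s (by simp)]
            refine sum_congr rfl fun i hi => ?_
            simp [ne_of_mem_erase hi]
      rw [hunion]
      exact s.finite_toSet.isClosed_biUnion fun k hk => ih _ (erase_ssubset hk)

end Cones

namespace ApproxEF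

open Finset

/-! ### Projections of systems and tight inequalities -/

namespace ExtSystem

variable {ι : Type} [Fintype ι]

theorem convex_proj (S : ExtSystem ι) : Convex ℝ S.proj := by
  rintro x ⟨y, hy, hy0⟩ x' ⟨y', hy', hy0'⟩ a b ha hb hab
  refine ⟨a • y + b • y', ?_, fun j => ?_⟩
  · simp only [Matrix.mulVec_add, Matrix.mulVec_smul]
    calc _ = a • (S.E.mulVec x + S.F.mulVec y) + b • (S.E.mulVec x' + S.F.mulVec y') := by
          simp only [smul_add]; abel
      _ = S.g := by rw [hy, hy', ← add_smul, hab, one_smul]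
  · exact add_nonneg (mul_nonneg ha (hy0 j)) (mul_nonneg hb (hy0' j))

theorem isClosed_proj (S : ExtSystem ι) : IsClosed S.proj := by
  have h := isClosed_conicalCombinations (fun j => S.F.col j) univ
  have hc : Continuous fun x : ι → ℝ => S.g - S.E.mulVec x :=
    continuous_const.sub (Continuous.matrix_mulVec continuous_const continuous_id)
  convert h.preimage hc using 1
  ext x
  simp only [proj, Set.mem_ofPred_eq, Set.mem_preimage, mem_univ, true_imp_iff]
  refine exists_congr fun y => ?_
  have : ∑ j, y j • S.F.col j = S.F.mulVec y := by
    ext i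
    simp [Matrix.mulVec, dotProduct, mul_comm]
  rw [this, eq_sub_iff_add_eq', and_comm]

/-- If a linear form attains its maximum `0` over the projection at the points of a nonempty
finite family, but not at `x₀`, then some inequality is tight at the whole family and not at
`x₀`. -/
theorem exists_tight_of_dotProduct_neg (S : ExtSystem ι) {w : ι → ℝ}
    (hw : ∀ x ∈ S.proj, w ⬝ᵥ x ≤ 0) {κ : Type*} {T : Finset κ} (hT : T.Nonempty)
    {x : κ → ι → ℝ} {y : κ → Fin S.r → ℝ}
    (hxy : ∀ k ∈ T, S.E.mulVec (x k) + S.F.mulVec (y k) = S.g) (hy : ∀ k ∈ T, ∀ j, 0 ≤ y k j)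
    (hwx : ∀ k ∈ T, w ⬝ᵥ x k = 0) {x₀ : ι → ℝ} {y₀ : Fin S.r → ℝ}
    (hxy₀ : S.E.mulVec x₀ + S.F.mulVec y₀ = S.g) (hy₀ : ∀ j, 0 ≤ y₀ j) (hwx₀ : w ⬝ᵥ x₀ < 0) :
    ∃ j, (∀ k ∈ T, y k j = 0) ∧ y₀ j ≠ 0 := by
  by_contra! hcon
  have hY : ∀ j, 0 ≤ ∑ k ∈ T, y k j := fun j => sum_nonneg fun k hk => hy k hk j
  have hpos : ∀ j, 0 < y₀ j → 0 < ∑ k ∈ T, y k j := fun j hj => by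
    refine (hY j).lt_of_ne fun h => hj.ne' (hcon j ?_)
    exact (sum_eq_zero_iff_of_nonneg fun k hk => hy k hk j).1 h.symm
  set M : ℝ := 2 + ∑ j, y₀ j / ∑ k ∈ T, y k j with hM
  have hq : ∀ j, 0 ≤ y₀ j / ∑ k ∈ T, y k j := fun j => div_nonneg (hy₀ j) (hY j)
  have hM2 : 2 ≤ M := by
    have := sum_nonneg fun j (_ : j ∈ univ) => hq j
    linarith
  have hMj : ∀ j, y₀ j ≤ M * ∑ k ∈ T, y k j := fun j => by
    rcases (hy₀ j).eq_or_lt with h | h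
    · rw [← h]; exact mul_nonneg (by linarith) (hY j)
    · rw [← div_le_iff₀ (hpos j h)]
      have := single_le_sum (fun j (_ : j ∈ univ) => hq j) (mem_univ j)
      linarith
  have hN : (1 : ℝ) ≤ #T := by exact_mod_cast hT.card_pos
  set D : ℝ := M * #T - 1 with hD
  have hD0 : 0 < D := by nlinarith
  -- This affine combination continues the segment from `x₀` beyond the barycentre of the tight
  -- points, where `w` becomes positive.
  have hmem : D⁻¹ • (M • ∑ k ∈ T, x k - x₀) ∈ S.proj := by
    refine ⟨D⁻¹ • (M • ∑ k ∈ T, y k - y₀), ?_, fun j => ?_⟩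
    · have hsum : S.E.mulVec (∑ k ∈ T, x k) + S.F.mulVec (∑ k ∈ T, y k) = (#T : ℝ) • S.g := by
        rw [Matrix.mulVec_sum, Matrix.mulVec_sum, ← sum_add_distrib, sum_congr rfl hxy]
        simp [Nat.cast_smul_eq_nsmul]
      simp only [Matrix.mulVec_smul, Matrix.mulVec_sub]
      calc _ = D⁻¹ • (M • (S.E.mulVec (∑ k ∈ T, x k) + S.F.mulVec (∑ k ∈ T, y k)) -
              (S.E.mulVec x₀ + S.F.mulVec y₀)) := by
            simp only [smul_add, smul_sub]; abel
        _ = D⁻¹ • D • S.g := by rw [hsum, hxy₀, smul_smul, hD, sub_smul, one_smul]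
        _ = S.g := inv_smul_smul₀ hD0.ne' _
    · simp only [Pi.smul_apply, Pi.sub_apply, smul_eq_mul, Finset.sum_apply]
      exact mul_nonneg (inv_nonneg.2 hD0.le) (sub_nonneg.2 (hMj j))
  have h := hw _ hmem
  rw [dotProduct_smul, dotProduct_sub, dotProduct_smul, dotProduct_sum, sum_congr rfl hwx,
    sum_const_zero, smul_zero, zero_sub, smul_eq_mul] at h
  have := mul_pos (inv_pos.2 hD0) (neg_pos.2 hwx₀)
  linarith

/-- Every finite family of points has an extended formulation of its convex hull. -/
theorem exists_proj_eq_convexHull {κ : Type} [Fintype κ] (v : κ → ι → ℝ) :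
    ∃ S : ExtSystem ι, S.proj = convexHull ℝ (Set.range v) := by
  classical
  let e := Fintype.equivFin (Option ι)
  let f := Fintype.equivFin κ
  -- The `none` row says that the `y j` sum to `1`; the row `some k` is coordinate `k` of `x = ∑ y j
  -- • v j`.
  let S : ExtSystem ι :=
    { m := Fintype.card (Option ι)
      r := Fintype.card κ
      E := Matrix.of fun i i' => (e.symm i).elim 0 fun k => if k = i' then 1 else 0
      F := Matrix.of fun i j => (e.symm i).elim 1 fun k => -v (f.symm j) k
      g := fun i => (e.symm i).elim 1 fun _ => 0 }
  have hS : ∀ x (y : Fin (Fintype.card κ) → ℝ), S.E.mulVec x + S.F.mulVec y = S.g ↔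
      ∑ j, y j = 1 ∧ ∑ j, y j • v (f.symm j) = x := by
    intro x y
    rw [funext_iff, e.symm.forall_congr_left, Option.forall]
    refine and_congr ?_ ?_
    · simp [S, Matrix.mulVec, dotProduct]
    · rw [funext_iff]
      refine forall_congr' fun k => ?_
      simp only [S, Matrix.mulVec, dotProduct, Pi.add_apply, Matrix.of_apply, Equiv.symm_symm,
        Equiv.symm_apply_apply, Option.elim_some, ite_mul, one_mul, zero_mul, sum_ite_eq,
        mem_univ, if_true, neg_mul, sum_neg_distrib, Finset.sum_apply, Pi.smul_apply, smul_eq_mul,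
        add_neg_eq_zero, mul_comm (y _)]
      exact eq_comm
  refine ⟨S, Set.Subset.antisymm ?_ (convexHull_min ?_ S.convex_proj)⟩
  · rintro x ⟨y, hxy, hy⟩
    obtain ⟨h1, rfl⟩ := (hS x y).1 hxy
    exact (convex_convexHull ℝ _).sum_mem (fun j _ => hy j) h1 fun j _ =>
      subset_convexHull ℝ _ ⟨_, rfl⟩
  · rintro _ ⟨k, rfl⟩
    refine ⟨Pi.single (f k) 1, (hS _ _).2 ⟨by simp, ?_⟩, fun j => ?_⟩
    · rw [sum_eq_single (f k)] <;> simp +contextual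
    · exact (Pi.single_nonneg (α := fun _ => ℝ)).2 zero_le_one j

end ExtSystem

/-! ### Hypermetric inequalities and the size bound -/

section Cuts

variable {n : ℕ}

/-- The edge weights `z u * z v`, the coefficients of the hypermetric inequality of `z`. -/
noncomputable def hypermetricWeight (z : Fin n → ℤ) : Edge n → ℝ := fun e =>
  Sym2.lift ⟨fun u v => (z u : ℝ) * z v, fun _ _ => mul_comm _ _⟩ (e : Sym2 (Fin n))

theorem hypermetricWeight_dotProduct_cutVector (z : Fin n → ℤ) (X : Set (Fin n))
    [DecidablePred (· ∈ X)] : hypermetricWeight z ⬝ᵥ cutVector X =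
      (((∑ v, if v ∈ X then z v else 0) * (∑ v, if v ∈ X then 0 else z v) : ℤ) : ℝ) := by
  classical
  have hL : hypermetricWeight z ⬝ᵥ cutVector X =
      ∑ e ∈ univ.filter (· ∈ cut X), hypermetricWeight z e := by
    simp [dotProduct, cutVector, Set.indicator_apply, sum_filter]
  have hR : (∑ v, if v ∈ X then z v else 0) * (∑ v, if v ∈ X then 0 else z v) =
      ∑ p ∈ univ.filter (· ∈ X) ×ˢ univ.filter (· ∉ X), z p.1 * z p.2 := by
    rw [sum_product, ← sum_mul_sum, sum_filter, sum_filter]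
    simp only [ite_not]
  rw [hL, hR]
  push_cast
  symm
  have hne : ∀ p ∈ univ.filter (· ∈ X) ×ˢ univ.filter (· ∉ X), p.1 ≠ p.2 := by
    rintro ⟨u, v⟩ hp (rfl : u = v)
    simp at hp
  refine sum_bij (fun p hp => ⟨s(p.1, p.2), by simpa using hne p hp⟩) ?_ ?_ ?_ ?_
  · rintro ⟨u, v⟩ hp
    simp only [mem_product, mem_filter, mem_univ, true_and] at hp ⊢
    exact ⟨u, hp.1, v, hp.2, rfl⟩
  · rintro ⟨u, v⟩ hp ⟨u', v'⟩ hp' h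
    simp only [mem_product, mem_filter, mem_univ, true_and] at hp hp'
    simp only [Subtype.mk.injEq, Sym2.eq_iff] at h
    rcases h with h | ⟨rfl, rfl⟩
    · exact Prod.ext h.1 h.2
    · exact absurd hp.1 hp'.2
  · rintro ⟨e, he⟩ hcut
    obtain ⟨u, hu, v, hv, rfl⟩ := (mem_filter.1 hcut).2
    exact ⟨(u, v), by simp [hu, hv], rfl⟩
  · rintro ⟨u, v⟩ _
    rfl

theorem hypermetricWeight_dotProduct_cutVector_of_sum_eq_one {z : Fin n → ℤ} (hz : ∑ v, z v = 1)
    (X : Set (Fin n)) [DecidablePred (· ∈ X)] : hypermetricWeight z ⬝ᵥ cutVector X =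
      (((∑ v, if v ∈ X then z v else 0) * (1 - ∑ v, if v ∈ X then z v else 0) : ℤ) : ℝ) := by
  have h : (∑ v, if v ∈ X then 0 else z v) = 1 - ∑ v, if v ∈ X then z v else 0 := by
    rw [← hz, ← sum_sub_distrib]
    refine sum_congr rfl fun v _ => ?_
    split_ifs <;> simp
  rw [hypermetricWeight_dotProduct_cutVector, h]

/-- Integrality is essential: `t * (1 - t)` is positive only for `0 < t < 1`. -/
theorem hypermetricWeight_dotProduct_cutVector_nonpos {z : Fin n → ℤ} (hz : ∑ v, z v = 1)
    (X : Set (Fin n)) : hypermetricWeight z ⬝ᵥ cutVector X ≤ 0 := by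
  classical
  rw [hypermetricWeight_dotProduct_cutVector_of_sum_eq_one hz]
  set t := ∑ v, if v ∈ X then z v else 0
  have : t * (1 - t) ≤ 0 := by
    rcases le_or_gt t 0 with h | h <;> nlinarith
  exact_mod_cast this

theorem cutVector_empty : cutVector (∅ : Set (Fin n)) = 0 := by
  ext e
  simp [cutVector, cut]

variable {m : ℕ}

/-- The vertex weights that make `hypermetricWeight` depend on `#(a ∩ b)` only, at the cuts
`rootedSet b`. -/
def vertexWeight (a : Finset (Fin m)) : Fin (m + 2) → ℤ :=
  Fin.cons (-1) (Fin.cons (2 - #a) fun i => if i ∈ a then 1 else 0)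

/-- The vertex set `{0} ∪ b`, with `b` placed on the last `m` vertices. -/
def rootedSet (b : Finset (Fin m)) : Set (Fin (m + 2)) :=
  {v | (Fin.cons True (Fin.cons False (· ∈ b)) : Fin (m + 2) → Prop) v}

theorem sum_vertexWeight (a : Finset (Fin m)) : ∑ v, vertexWeight a v = 1 := by
  simp [vertexWeight, Fin.sum_univ_succ]

theorem hypermetricWeight_vertexWeight_dotProduct (a b : Finset (Fin m)) :
    hypermetricWeight (vertexWeight a) ⬝ᵥ cutVector (rootedSet b) =
      ((#(a ∩ b) : ℝ) - 1) * (2 - #(a ∩ b)) := by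
  classical
  have h : (∑ v, if v ∈ rootedSet b then vertexWeight a v else 0) = (#(a ∩ b) : ℤ) - 1 := by
    have : ∀ i, (if i ∈ b then if i ∈ a then (1 : ℤ) else 0 else 0) =
        if i ∈ a ∩ b then 1 else 0 := fun i => by
      by_cases i ∈ a <;> by_cases i ∈ b <;> simp [*]
    simp only [Fin.sum_univ_succ (n := m + 1), Fin.sum_univ_succ (n := m), rootedSet,
      vertexWeight, Set.mem_ofPred_eq, Fin.cons_zero, Fin.cons_succ, if_true, if_false, this,
      sum_boole, filter_mem_eq_inter, univ_inter]
    ring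
  rw [hypermetricWeight_dotProduct_cutVector_of_sum_eq_one (sum_vertexWeight a), h]
  push_cast
  ring

/-- A system whose projection contains all cut vectors and satisfies all homogeneous inequalities
valid for them has exponential size. -/
theorem three_pow_le_size (S : ExtSystem (Edge (m + 2))) (hcut : ∀ X, cutVector X ∈ S.proj)
    (hvalid : ∀ w : Edge (m + 2) → ℝ, (∀ X, w ⬝ᵥ cutVector X ≤ 0) → ∀ x ∈ S.proj, w ⬝ᵥ x ≤ 0) :
    3 ^ m ≤ S.size * 2 ^ m := by
  classical
  choose y hy hy0 using hcut
  have h := three_pow_le_of_rectangle_cover (κ := Fin S.r) (univ : Finset (Fin m))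
    -- Demanding `y X j = 0` at every cut tight for `a` makes this a condition on `a` alone. If `#(a
    -- ∩ b) = 1`, then `rootedSet b` is tight, which contradicts the condition on `b`.
    (fun j a => ∀ X, hypermetricWeight (vertexWeight a) ⬝ᵥ cutVector X = 0 → y X j = 0)
    (fun j b => y (rootedSet b) j ≠ 0) (fun j a b hP hQ hab => hQ (hP _ ?_)) fun a b hab => ?_
  · simpa [ExtSystem.size] using h
  · rw [hypermetricWeight_vertexWeight_dotProduct, hab]
    simp
  · have hT : (univ.filter fun X : Set (Fin (m + 2)) =>
        hypermetricWeight (vertexWeight a) ⬝ᵥ cutVector X = 0).Nonempty :=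
      ⟨∅, by simp [cutVector_empty]⟩
    obtain ⟨j, hj, hj'⟩ := S.exists_tight_of_dotProduct_neg
      (hvalid _ (hypermetricWeight_dotProduct_cutVector_nonpos (sum_vertexWeight a))) hT
      (fun X _ => hy X) (fun X _ => hy0 X) (fun X hX => (mem_filter.1 hX).2) (hy (rootedSet b))
      (hy0 _) (by
        rw [hypermetricWeight_vertexWeight_dotProduct, disjoint_iff_inter_eq_empty.1 hab]
        norm_num)
    exact ⟨j, fun X hX => hj X (by simpa using hX), hj'⟩

/-- Since `√2 ≤ 3 / 2`, the size is at least `2 ^ (m / 2)`, and `m ≥ 2` gives `m / 2 ≥ (m + 2) / 4`.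
-/
theorem two_rpow_le_size {S : ExtSystem (Edge n)} (hn : 4 ≤ n) (hcut : ∀ X, cutVector X ∈ S.proj)
    (hvalid : ∀ w : Edge n → ℝ, (∀ X, w ⬝ᵥ cutVector X ≤ 0) → ∀ x ∈ S.proj, w ⬝ᵥ x ≤ 0) :
    (2 : ℝ) ^ (1 / 4 * (n : ℝ)) ≤ (S.size : ℝ) := by
  obtain ⟨m, rfl⟩ := Nat.exists_eq_add_of_le' (show 2 ≤ n by omega)
  have h : (3 : ℝ) ^ m ≤ S.size * 2 ^ m := by exact_mod_cast three_pow_le_size S hcut hvalid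
  have hm : (2 : ℝ) ≤ m := by exact_mod_cast (by omega : 2 ≤ m)
  have h32 : (2 : ℝ) ^ (1 / 2 : ℝ) ≤ 3 / 2 := by
    rw [← Real.sqrt_eq_rpow]
    exact Real.sqrt_le_iff.2 (by norm_num)
  calc (2 : ℝ) ^ (1 / 4 * ((m + 2 : ℕ) : ℝ)) ≤ 2 ^ (1 / 2 * (m : ℝ)) := by
        refine Real.rpow_le_rpow_of_exponent_le one_le_two ?_
        push_cast
        linarith
    _ = ((2 : ℝ) ^ (1 / 2 : ℝ)) ^ m := Real.rpow_mul_natCast zero_le_two _ _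
    _ ≤ (3 / 2) ^ m := by gcongr
    _ ≤ S.size := by rwa [div_pow, div_le_iff₀ (by positivity)]

/-! ### From approximation guarantees to homogeneous inequalities -/

theorem cutVector_mem_cutPolytope (X : Set (Fin n)) : cutVector X ∈ cutPolytope n :=
  subset_convexHull ℝ _ ⟨X, rfl⟩

theorem dotProduct_le_of_mem_cutPolytope {w : Edge n → ℝ} {c : ℝ}
    (hw : ∀ X, w ⬝ᵥ cutVector X ≤ c) {x : Edge n → ℝ} (hx : x ∈ cutPolytope n) :
    w ⬝ᵥ x ≤ c := by
  have hconv : Convex ℝ {x : Edge n → ℝ | w ⬝ᵥ x ≤ c} :=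
    convex_halfSpace_le ⟨dotProduct_add w, fun a x => dotProduct_smul a w x⟩ c
  refine convexHull_min ?_ hconv hx
  rintro _ ⟨X, rfl⟩
  exact hw X

theorem optValue_le_iff {ι : Type} [Fintype ι] {w : ι → ℝ} {K : Set (ι → ℝ)} {c : ℝ} :
    optValue w K ≤ (c : EReal) ↔ ∀ x ∈ K, w ⬝ᵥ x ≤ c := by
  simp [optValue]

/-- A closed convex set on which no linear form has a smaller supremum than on `P` contains `P`. -/
theorem subset_of_optValue_le {ι : Type} [Fintype ι] {P K : Set (ι → ℝ)} (hK : Convex ℝ K)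
    (hcl : IsClosed K) (h : ∀ w, optValue w P ≤ optValue w K) : P ⊆ K := by
  classical
  intro p hp
  by_contra hpK
  obtain ⟨f, u, hfu, huf⟩ := geometric_hahn_banach_closed_point hK hcl hpK
  have hf : ∀ x, (fun i => f (Pi.single i 1)) ⬝ᵥ x = f x := fun x => by
    conv_rhs => rw [pi_eq_sum_univ' x]
    simp [dotProduct, map_sum, mul_comm]
  have hle := (h fun i => f (Pi.single i 1)).trans
    (optValue_le_iff.2 fun x hx => (hf x).trans_le (hfu x hx).le)
  have := optValue_le_iff.1 hle p hp
  rw [hf] at this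
  linarith

theorem cutPolytope_subset_smul {ρ : ℝ} (hρ : 1 ≤ ρ) : cutPolytope n ⊆ ρ • cutPolytope n := by
  have hρ0 : 0 < ρ := by linarith
  intro x hx
  rw [Set.mem_smul_set_iff_inv_smul_mem₀ hρ0.ne']
  have h0 : (0 : Edge n → ℝ) ∈ cutPolytope n := cutVector_empty ▸ cutVector_mem_cutPolytope ∅
  exact (convex_convexHull ℝ _).smul_mem_of_zero_mem h0 hx
    ⟨inv_nonneg.2 hρ0.le, inv_le_one_of_one_le₀ hρ⟩

theorem two_rpow_le_size_of_isApproxEF {S : ExtSystem (Edge n)} {ρ : ℝ} (hn : 4 ≤ n)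
    (hS : S.IsApproxEF (maxCut n) ρ) : (2 : ℝ) ^ (1 / 4 * (n : ℝ)) ≤ (S.size : ℝ) := by
  have hsub : cutPolytope n ⊆ S.proj := subset_of_optValue_le S.convex_proj S.isClosed_proj hS.1
  refine two_rpow_le_size hn (fun X => hsub (cutVector_mem_cutPolytope X)) fun w hw => ?_
  -- The empty cut attains `0`, so the upper bound becomes `ρ * 0 = 0`.
  have h0 : optValue w (maxCut n).hull = 0 := by
    refine le_antisymm ?_ ?_
    · exact optValue_le_iff.2 fun x hx => dotProduct_le_of_mem_cutPolytope hw hx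
    · refine le_iSup₂_of_le (cutVector ∅) (cutVector_mem_cutPolytope ∅) ?_
      simp [cutVector_empty]
  have h := hS.2 w (Set.mem_univ w)
  rw [h0, mul_zero] at h
  exact optValue_le_iff.1 h

theorem two_rpow_le_size_of_isEFOfPair {S : ExtSystem (Edge n)} {ρ : ℝ} (hρ : 1 ≤ ρ) (hn : 4 ≤ n)
    (hS : S.IsEFOfPair (cutPolytope n) (ρ • cutPolytope n)) :
    (2 : ℝ) ^ (1 / 4 * (n : ℝ)) ≤ (S.size : ℝ) := by
  refine two_rpow_le_size hn (fun X => hS.1 (cutVector_mem_cutPolytope X)) fun w hw x hx => ?_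
  obtain ⟨p, hp, rfl⟩ := hS.2 hx
  rw [dotProduct_smul, smul_eq_mul]
  exact mul_nonpos_of_nonneg_of_nonpos (by linarith) (dotProduct_le_of_mem_cutPolytope hw hp)

/-- Rules out the default value `0` of `sInf ∅`: a formulation of the cut polytope itself serves the
pair. -/
theorem exists_isEFOfPair_size_eq_xc {ρ : ℝ} (hρ : 1 ≤ ρ) :
    ∃ S : ExtSystem (Edge n), S.IsEFOfPair (cutPolytope n) (ρ • cutPolytope n) ∧
      S.size = xc (cutPolytope n) (ρ • cutPolytope n) := by
  classical
  refine Nat.sInf_mem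
    (s := {k | ∃ S : ExtSystem (Edge n), S.IsEFOfPair _ (ρ • cutPolytope n) ∧ S.size = k}) ?_
  obtain ⟨S, hS⟩ := ExtSystem.exists_proj_eq_convexHull fun X : Set (Fin n) => cutVector X
  exact ⟨S.size, S, ⟨hS.ge, hS.le.trans (cutPolytope_subset_smul hρ)⟩, rfl⟩

end Cuts

end ApproxEF

open ApproxEF
theorem proposition1 :
    ∃ c : ℝ, 0 < c ∧ ∃ N : ℕ, ∀ ρ : ℝ, 1 ≤ ρ → ∀ n : ℕ, N ≤ n →
      (∀ S : ExtSystem (Edge n), S.IsApproxEF (maxCut n) ρ →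
        (2 : ℝ) ^ (c * (n : ℝ)) ≤ (S.size : ℝ)) ∧
      (2 : ℝ) ^ (c * (n : ℝ)) ≤ (xc (cutPolytope n) (ρ • cutPolytope n) : ℝ) := by
  refine ⟨1 / 4, by norm_num, 4, fun ρ hρ n hn =>
    ⟨fun S hS => two_rpow_le_size_of_isApproxEF hn hS, ?_⟩⟩
  obtain ⟨S, hS, hsize⟩ := exists_isEFOfPair_size_eq_xc (n := n) hρ
  rw [← hsize]
  exact two_rpow_le_size_of_isEFOfPair hρ hn hS
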